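/- Let $\mathbb C_+=\{z\in\mathbb C:\operatorname{Im} z>0\}$. An analytic function $f:\mathbb C_+\to\mathbb C$ is called \emph{inner} if it is bounded and $\lim_{y\searrow 0}|f(x+iy)|=1$ for almost every $x\in\mathbb R$. A \emph{meromorphic inner function} is an inner function that admits a meromorphic continuation to the whole complex plane; the continuation is denoted by the same letter and is analytic at every point of $\mathbb R$. There is an absolute constant $\varepsilon_0>0$ such that the following holds for every $0<\varepsilon<\varepsilon_0$. Let $\theta$ be a meromorphic inner function and let $x,y\in\mathbb R$ satisfy $\theta'(y)\neq 0$ and $$\frac{|\theta'(x)|}{|\theta'(y)|}>1+\varepsilon .$$ Then the disk $\{z\in\mathbb C: |z-x|<4|y-x|/\varepsilon\}$ contains a zero of $\theta$. -/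

import Mathlib

open Filter Topology MeasureTheory

/-- `f` is an inner function on the upper half-plane `{Im z > 0}`: it is analytic and bounded there,
and for almost every real `x` we have `lim_{y ↘ 0} |f (x + i y)| = 1`. Only the values of `f` on the
open upper half-plane matter. -/
structure IsInnerFunction (f : ℂ → ℂ) : Prop where
  analytic : AnalyticOnNhd ℂ f {z : ℂ | 0 < z.im}
  bounded : ∃ C : ℝ, ∀ z : ℂ, 0 < z.im → ‖f z‖ ≤ C
  unimodular : ∀ᵐ x : ℝ ∂volume,
    Tendsto (fun y : ℝ => ‖f ((x : ℂ) + (y : ℂ) * Complex.I)‖) (𝓝[>] 0) (𝓝 1)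

/-- `θ` is a meromorphic inner function: `θ` is a meromorphic function on the whole complex plane
whose restriction to the upper half-plane is inner. A meromorphic function is represented by its
normal form: removable singularities are filled in, so that `θ` is analytic at every point that is
not a pole, and the value at a pole is the dummy value `0`. -/
structure IsMeromorphicInner (θ : ℂ → ℂ) : Prop where
  meromorphic : MeromorphicNFOn θ Set.univ
  inner : IsInnerFunction θ

/-- `z` is a zero of the meromorphic function `θ`: `θ` is analytic at `z` (so `z` is not a pole) and
vanishes there. -/
def IsZeroOf (θ : ℂ → ℂ) (z : ℂ) : Prop :=
  AnalyticAt ℂ θ z ∧ θ z = 0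

/-! On the real line `|θ'|` is the normal derivative of `-log |θ|`. Each zero `l` in the upper
half-plane contributes `2 Im l / |s - l|²` to it at `s`, and these contributions add without
cancellation. With `d = |y - x|`, suppose no zero lies within `4d/ε` of `x`. Then each contribution
changes by a factor at most `(1 + ε/4)² ≤ 1 + ε` between `y` and `x`.

The zeros within `400d/ε` of `x` are divided out one at a time (`exists_blaschke_factor`,
`norm_deriv_of_factor`). The quotient is zero-free there, so Schwarz reflection makes `-log` of its
modulus harmonic in a disk, odd under conjugation and nonnegative above the axis. A Harnack estimate
with the antisymmetrized Poisson kernel (`antisymmetric_harmonic_bounds`) again gives the factor `1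
+ ε`. Summing contradicts the assumed ratio. -/

/-- An inner function on the upper half-plane that extends analytically across the real line. -/
structure IsRegularInner (f : ℂ → ℂ) : Prop where
  analytic : AnalyticOnNhd ℂ f {z : ℂ | 0 ≤ z.im}
  norm_le_one : ∀ z : ℂ, 0 ≤ z.im → ‖f z‖ ≤ 1
  norm_ofReal : ∀ x : ℝ, ‖f x‖ = 1

/-! ### Maximum principle and regularity on the real line -/

theorem IsRegularInner.of_bounded {f : ℂ → ℂ} (hf : AnalyticOnNhd ℂ f {z : ℂ | 0 ≤ z.im})
    {C : ℝ} (hC : ∀ z : ℂ, 0 < z.im → ‖f z‖ ≤ C) (h1 : ∀ x : ℝ, ‖f x‖ = 1) :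
    IsRegularInner f := by
  refine ⟨hf, fun z hz => ?_, h1⟩
  -- Multiplication by `i` carries the right half-plane, where Phragmén–Lindelöf applies, to the
  -- upper one.
  have him (w : ℂ) : (Complex.I * w).im = w.re := by simp
  have key := PhragmenLindelof.right_half_plane_of_bounded_on_real (C := 1)
    (f := fun w => f (Complex.I * w)) (z := -Complex.I * z) ?_ ?_ ?_ ?_ (by simpa using hz)
  · simpa [← mul_assoc] using key
  · refine DifferentiableOn.diffContOnCl fun w hw => ?_
    have hw' : 0 ≤ w.re := by
      have := Complex.closure_setOfPred_lt_re 0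
      rw [this] at hw
      exact hw
    have h2 : DifferentiableAt ℂ f (Complex.I * w) :=
      (hf _ (by simpa using hw')).differentiableAt
    exact (h2.comp w (by fun_prop)).differentiableWithinAt
  · refine ⟨1, by norm_num, 0, ?_⟩
    refine Asymptotics.IsBigO.of_bound C ?_
    refine eventually_inf_principal.2 (Eventually.of_forall fun w hw => ?_)
    simpa using hC (Complex.I * w) (by simpa using hw)
  · refine ⟨C, ?_⟩
    rw [eventually_map]
    filter_upwards [eventually_gt_atTop 0] with t ht
    exact hC _ (by simpa using ht)
  · intro t
    have : Complex.I * (t * Complex.I) = ((-t : ℝ) : ℂ) := by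
      rw [mul_left_comm, Complex.I_mul_I]; simp
    simp only [this, h1, le_refl]

theorem tendsto_ofReal_add_mul_I (x : ℝ) :
    Tendsto (fun y : ℝ => (x : ℂ) + (y : ℂ) * Complex.I) (𝓝[>] 0) (𝓝[≠] (x : ℂ)) := by
  refine tendsto_nhdsWithin_iff.2 ⟨?_, ?_⟩
  · refine Tendsto.mono_left ?_ nhdsWithin_le_nhds
    exact Continuous.tendsto' (by fun_prop) _ _ (by simp)
  · filter_upwards [self_mem_nhdsWithin] with t ht h
    exact (ne_of_gt ht) (by simpa using congrArg Complex.im h)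

/-- A pole at `x` would make `|θ|` blow up along the vertical approach to `x`, against boundedness.
-/
theorem IsMeromorphicInner.analyticAt_ofReal {θ : ℂ → ℂ} (h : IsMeromorphicInner θ) (x : ℝ) :
    AnalyticAt ℂ θ x := by
  have hm : MeromorphicNFAt θ x := h.meromorphic (Set.mem_univ _)
  rw [← hm.meromorphicOrderAt_nonneg_iff_analyticAt]
  by_contra! hlt
  obtain ⟨C, hC⟩ := h.inner.bounded
  have h1 := (tendsto_norm_atTop_iff_cobounded.2
    (tendsto_cobounded_of_meromorphicOrderAt_neg hlt)).comp (tendsto_ofReal_add_mul_I x)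
  obtain ⟨t, ht, ht0⟩ := ((h1.eventually_gt_atTop C).and self_mem_nhdsWithin).exists
  exact absurd (hC _ (by simpa using ht0)) (not_le.2 ht)

theorem IsMeromorphicInner.isRegularInner {θ : ℂ → ℂ} (h : IsMeromorphicInner θ) :
    IsRegularInner θ := by
  obtain ⟨C, hC⟩ := h.inner.bounded
  have hR := h.analyticAt_ofReal
  refine .of_bounded (fun z hz => ?_) hC ?_
  · rcases (show 0 ≤ z.im from hz).eq_or_lt with h0 | h0
    · rw [show z = (z.re : ℂ) from Complex.ext rfl (by simpa using h0.symm)]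
      exact hR _
    · exact h.inner.analytic z h0
  · have hcont : Continuous fun x : ℝ => ‖θ x‖ := by
      refine continuous_iff_continuousAt.2 fun x => ?_
      exact ((hR x).continuousAt.comp (f := fun x : ℝ => (x : ℂ)) (by fun_prop)).norm
    refine fun x => congrFun (Measure.eq_of_ae_eq (μ := volume) (f := fun x : ℝ => ‖θ x‖)
      (g := fun _ => 1) ?_ hcont continuous_const) x
    filter_upwards [h.inner.unimodular] with x hx
    refine tendsto_nhds_unique ?_ hx
    exact ((hR x).continuousAt.tendsto.mono_left nhdsWithin_le_nhds).norm.comp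
      (tendsto_ofReal_add_mul_I x)

/-! ### Boundary derivatives and Blaschke factors -/

/-- At a real point the logarithmic derivative of a regular inner function is `i` times a
nonnegative real number. -/
theorem IsRegularInner.deriv_ofReal {f : ℂ → ℂ} (hf : IsRegularInner f) (s : ℝ) :
    deriv f s = Complex.I * ‖deriv f s‖ * f s := by
  have hd : HasDerivAt f (deriv f s) (s : ℂ) :=
    (hf.analytic s (by simp)).differentiableAt.hasDerivAt
  have hfs : f s * (starRingEnd ℂ) (f s) = 1 := by
    rw [Complex.mul_conj, Complex.normSq_eq_norm_sq, hf.norm_ofReal]; simp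
  set A : ℂ := deriv f s * (starRingEnd ℂ) (f s) with hA
  have hAf : deriv f s = A * f s := by rw [hA, mul_assoc, mul_comm (starRingEnd ℂ _), hfs, mul_one]
  have hnorm : ‖deriv f s‖ = ‖A‖ := by rw [hAf, norm_mul, hf.norm_ofReal, mul_one]
  -- Derivative of `|f|²` in direction `v`. Direction `1`, where `|f|` is constant, gives `Re A =
  -- 0`; direction `i`, where `|f|` starts from its maximum, gives `Im A ≥ 0`.
  have key (v : ℂ) : HasDerivAt (fun t : ℝ => ‖f (s + t * v)‖ ^ 2) (2 * (v * A).re) 0 := by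
    have h1 : HasDerivAt (fun t : ℝ => (s : ℂ) + t * v) v 0 := by
      simpa using ((Complex.ofRealCLM.hasDerivAt (x := (0 : ℝ))).mul_const v).const_add (s : ℂ)
    have h2 : HasDerivAt (fun t : ℝ => f (s + t * v)) (deriv f s * v) 0 := by
      refine HasDerivAt.comp (h₂ := f) (0 : ℝ) (by simpa using hd) h1
    have h3 := h2.norm_sq
    convert h3 using 1
    simp only [Complex.ofReal_zero, zero_mul, add_zero, Complex.inner, hA]
    congr 2
    ring
  have hre : A.re = 0 := by
    have h := key 1
    have h' : (fun t : ℝ => ‖f (s + t * 1)‖ ^ 2) = fun _ => (1 : ℝ) := by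
      ext t
      have := hf.norm_ofReal (s + t)
      push_cast at this
      rw [mul_one, this, one_pow]
    rw [h'] at h
    have := h.unique (hasDerivAt_const (0 : ℝ) (1 : ℝ))
    simpa using this
  have him : 0 ≤ A.im := by
    have h := (key Complex.I).hasDerivWithinAt (s := Set.Ici 0)
    have hmax : IsLocalMaxOn (fun t : ℝ => ‖f (s + t * Complex.I)‖ ^ 2) (Set.Ici 0) 0 := by
      filter_upwards [self_mem_nhdsWithin] with t ht
      simp only [Complex.ofReal_zero, zero_mul, add_zero, hf.norm_ofReal]
      exact pow_le_pow_left₀ (norm_nonneg _) (hf.norm_le_one _ (by simpa using ht)) 2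
    have := hmax.hasFDerivWithinAt_nonpos h.hasFDerivWithinAt (y := 1)
      (mem_posTangentConeAt_of_segment_subset (by
        rw [zero_add, segment_eq_Icc zero_le_one]; exact Set.Icc_subset_Ici_self))
    simpa using this
  have hA2 : A = Complex.I * ‖A‖ := by
    have : A = Complex.I * (A.im : ℂ) := by
      apply Complex.ext <;> simp [hre]
    rw [this]; simp [abs_of_nonneg him]
  rw [hnorm, ← hA2, ← hAf]

/-- Comparison with `deriv_ofReal` forces the sign of `a`, so nonnegativity need not be assumed. -/
theorem IsRegularInner.norm_deriv_eq {f : ℂ → ℂ} (hf : IsRegularInner f) {s a : ℝ}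
    (h : deriv f s = Complex.I * a * f s) : ‖deriv f s‖ = a := by
  have h1 := hf.deriv_ofReal s
  rw [h] at h1
  have h0 : f s ≠ 0 := by
    rw [← norm_ne_zero_iff, hf.norm_ofReal]; exact one_ne_zero
  have h2 := mul_left_cancel₀ Complex.I_ne_zero (mul_right_cancel₀ h0 h1)
  rw [h]
  exact_mod_cast h2.symm

/-- Division of a regular inner function by the Blaschke factor of one of its zeros. -/
theorem IsRegularInner.exists_blaschke_factor {f : ℂ → ℂ} (hf : IsRegularInner f) {l : ℂ}
    (hl : 0 < l.im) (h0 : f l = 0) :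
    ∃ g : ℂ → ℂ, IsRegularInner g ∧
      ∀ z : ℂ, (z - starRingEnd ℂ l) * f z = (z - l) * g z := by
  set m := starRingEnd ℂ l with hm
  set g : ℂ → ℂ := fun z => (z - m) * dslope f l z with hg
  have hfg (z : ℂ) : (z - m) * f z = (z - l) * g z := by
    have := sub_smul_dslope_of_zero h0 z
    rw [smul_eq_mul] at this
    rw [hg, ← this]; ring
  have hga : AnalyticOnNhd ℂ g {z : ℂ | 0 ≤ z.im} := by
    have hbig : AnalyticOnNhd ℂ f {z | AnalyticAt ℂ f z} := fun z hz => hz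
    have hopen : IsOpen {z | AnalyticAt ℂ f z} := isOpen_analyticAt ℂ f
    have hd : DifferentiableOn ℂ (dslope f l) {z | AnalyticAt ℂ f z} :=
      (Complex.differentiableOn_dslope (hopen.mem_nhds (hf.analytic l hl.le))).2
        hbig.differentiableOn
    have : AnalyticOnNhd ℂ g {z | AnalyticAt ℂ f z} :=
      DifferentiableOn.analyticOnNhd (by fun_prop) hopen
    exact this.mono hf.analytic
  have hnorm (z : ℂ) (hz : z ≠ l) : ‖g z‖ = ‖z - m‖ / ‖z - l‖ * ‖f z‖ := by
    have h1 : ‖z - l‖ ≠ 0 := norm_ne_zero_iff.2 (sub_ne_zero.2 hz)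
    have := congrArg norm (hfg z)
    rw [norm_mul, norm_mul] at this
    field_simp
    linarith
  have hball : Metric.closedBall l (l.im / 2) ⊆ {z : ℂ | 0 ≤ z.im} := fun z hz => by
    rw [Metric.mem_closedBall, dist_eq_norm] at hz
    have := (abs_le.1 ((Complex.abs_im_le_norm (z - l)).trans hz)).1
    rw [Complex.sub_im] at this
    simp only [Set.mem_ofPred_eq]; linarith
  obtain ⟨C, hC⟩ := (isCompact_closedBall l (l.im / 2)).exists_bound_of_continuousOn
    (hga.continuousOn.mono hball)
  -- Outside the small ball `|z - l| > Im l / 2`, hence `|z - l̄| ≤ |z - l| + 2 Im l ≤ 5 |z - l|`.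
  refine ⟨g, .of_bounded hga (C := max C 5) (fun z hz => ?_) (fun x => ?_), hfg⟩
  · by_cases hzl : z ∈ Metric.closedBall l (l.im / 2)
    · exact (hC z hzl).trans (le_max_left _ _)
    · rw [Metric.mem_closedBall, dist_eq_norm, not_le] at hzl
      have hpos : 0 < ‖z - l‖ := by linarith
      refine le_trans ?_ (le_max_right _ _)
      rw [hnorm z (by rintro rfl; simp at hpos)]
      refine (mul_le_of_le_one_right (by positivity) (hf.norm_le_one z hz.le)).trans ?_
      rw [div_le_iff₀ hpos]
      have h2 : z - m = (z - l) + (l - m) := by ring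
      have h3 : ‖l - m‖ = 2 * l.im := by
        rw [hm, Complex.sub_conj, norm_mul, Complex.norm_I, mul_one, Complex.norm_real,
          Real.norm_of_nonneg (by linarith)]
      have := norm_add_le (z - l) (l - m)
      rw [← h2, h3] at this
      linarith
  · have hx : (x : ℂ) ≠ l := by rintro rfl; simp at hl
    rw [hnorm _ hx, hf.norm_ofReal, mul_one]
    have : ‖(x : ℂ) - m‖ = ‖(x : ℂ) - l‖ := by
      rw [← Complex.norm_conj ((x : ℂ) - l), map_sub, Complex.conj_ofReal]
    rw [this, div_self (norm_ne_zero_iff.2 (sub_ne_zero.2 hx))]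

/-- Logarithmic derivatives add, and all of them are `i` times nonnegative reals, so the moduli add
as well. -/
theorem IsRegularInner.norm_deriv_of_factor {f g : ℂ → ℂ} (hf : IsRegularInner f)
    (hg : IsRegularInner g) {l : ℂ} (hl : 0 < l.im)
    (hfg : ∀ z : ℂ, (z - starRingEnd ℂ l) * f z = (z - l) * g z) (s : ℝ) :
    ‖deriv f s‖ = 2 * l.im / ‖(s : ℂ) - l‖ ^ 2 + ‖deriv g s‖ := by
  refine hf.norm_deriv_eq ?_
  have hfd : HasDerivAt f (deriv f s) (s : ℂ) :=
    (hf.analytic s (by simp)).differentiableAt.hasDerivAt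
  have hgd : HasDerivAt g (deriv g s) (s : ℂ) :=
    (hg.analytic s (by simp)).differentiableAt.hasDerivAt
  have h1 := ((hasDerivAt_id (s : ℂ)).sub_const (starRingEnd ℂ l)).mul hfd
  have h2 := ((hasDerivAt_id (s : ℂ)).sub_const l).mul hgd
  have heq : ((fun z => id z - starRingEnd ℂ l) * f) = (fun z => id z - l) * g :=
    funext fun z => hfg z
  rw [heq] at h1
  have h3 := h1.unique h2
  simp only [id, one_mul] at h3
  have hs := hfg s
  have hsl : (s : ℂ) - l ≠ 0 := by
    rw [sub_ne_zero]; rintro rfl; simp at hl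
  have hsm : (s : ℂ) - starRingEnd ℂ l ≠ 0 := by
    have := (map_ne_zero (starRingEnd ℂ)).2 hsl
    rwa [map_sub, Complex.conj_ofReal] at this
  have hN : (((‖(s : ℂ) - l‖ ^ 2 : ℝ)) : ℂ) = (s - l) * (s - starRingEnd ℂ l) := by
    rw [← Complex.normSq_eq_norm_sq, ← Complex.mul_conj, map_sub, Complex.conj_ofReal]
  have hI : l - starRingEnd ℂ l = 2 * l.im * Complex.I := by
    rw [Complex.sub_conj]; push_cast; ring
  rw [hg.deriv_ofReal s] at h3
  have hgs : g s = ((s : ℂ) - starRingEnd ℂ l) * f s / (s - l) := by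
    field_simp; rw [hs, mul_comm]
  rw [hgs] at h3
  push_cast at hN
  push_cast
  rw [hN]
  refine mul_left_cancel₀ hsm ?_
  have h4 : ((s : ℂ) - starRingEnd ℂ l) * deriv f s = ((s : ℂ) - starRingEnd ℂ l) * f s / (s - l)
     + (s - l) * (Complex.I * ‖deriv g s‖ * (((s : ℂ) - starRingEnd ℂ l) * f s / (s - l))) - f s := by
    rw [← h3]; ring
  rw [h4]
  field_simp
  linear_combination (f s) * hI

/-! ### Reflection and Harnack bounds -/

/-- **Schwarz reflection** of a zero-free regular inner function. -/
theorem IsRegularInner.exists_reflection {f : ℂ → ℂ} (hf : IsRegularInner f) {x R : ℝ}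
    (h0 : ∀ z ∈ Metric.ball (x : ℂ) R, 0 < z.im → f z ≠ 0) :
    ∃ g : ℂ → ℂ, AnalyticOnNhd ℂ g (Metric.ball x R) ∧ (∀ z ∈ Metric.ball (x : ℂ) R, g z ≠ 0) ∧
      (∀ z : ℂ, 0 ≤ z.im → g z = f z) ∧
      ∀ z : ℂ, ‖g (starRingEnd ℂ z)‖ = ‖g z‖⁻¹ := by
  classical
  have hreal (s : ℝ) : f s ≠ 0 := by
    rw [← norm_ne_zero_iff, hf.norm_ofReal]; exact one_ne_zero
  have h0' (z : ℂ) (hz : z ∈ Metric.ball (x : ℂ) R) (him : 0 ≤ z.im) : f z ≠ 0 := by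
    rcases him.eq_or_lt with h | h
    · rw [show z = (z.re : ℂ) from Complex.ext rfl (by simpa using h.symm)]
      exact hreal _
    · exact h0 z hz h
  have hconj (z : ℂ) (hz : z ∈ Metric.ball (x : ℂ) R) :
      starRingEnd ℂ z ∈ Metric.ball (x : ℂ) R := by
    rwa [Metric.mem_ball, ← Complex.conj_ofReal x, Complex.dist_conj_conj]
  set F : ℂ → ℂ := fun z => (starRingEnd ℂ (f (starRingEnd ℂ z)))⁻¹ with hF
  set g : ℂ → ℂ := fun z => if 0 ≤ z.im then f z else F z with hg
  have hFa (z : ℂ) (hz : z ∈ Metric.ball (x : ℂ) R) (him : z.im ≤ 0) : AnalyticAt ℂ F z := by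
    have him' : 0 ≤ (starRingEnd ℂ z).im := by simpa using him
    have h1 : ∀ᶠ w in 𝓝 (starRingEnd ℂ z), AnalyticAt ℂ f w :=
      (isOpen_analyticAt ℂ f).mem_nhds (hf.analytic _ him')
    have h2 : ∀ᶠ w in 𝓝 z, AnalyticAt ℂ f (starRingEnd ℂ w) :=
      Complex.continuous_conj.continuousAt.eventually h1
    have h3 : AnalyticAt ℂ (fun w => starRingEnd ℂ (f (starRingEnd ℂ w))) z := by
      rw [Complex.analyticAt_iff_eventually_differentiableAt]
      filter_upwards [h2] with w hw
      exact differentiableAt_conj_conj_iff.2 hw.differentiableAt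
    refine h3.inv ?_
    simpa using h0' _ (hconj z hz) him'
  have hFreal (s : ℝ) : F s = f s := by
    have : f s * starRingEnd ℂ (f s) = 1 := by
      rw [Complex.mul_conj, Complex.normSq_eq_norm_sq, hf.norm_ofReal]; simp
    simp only [hF, Complex.conj_ofReal]
    exact inv_eq_of_mul_eq_one_left this
  refine ⟨g, fun z hz => ?_, fun z hz => ?_, fun z hz => if_pos hz, fun z => ?_⟩
  · rcases lt_trichotomy z.im 0 with him | him | him
    · refine (hFa z hz him.le).congr ?_
      filter_upwards [(isOpen_lt Complex.continuous_im continuous_const).mem_nhds him] with w hw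
      exact (if_neg (not_le.2 hw)).symm
    · have hfz : AnalyticAt ℂ f z := hf.analytic z him.ge
      refine hfz.congr ?_
      -- Identity theorem: the two analytic branches agree on the real line, which accumulates at
      -- `z`.
      have hev : f =ᶠ[𝓝 z] F := by
        refine (hfz.frequently_eq_iff_eventually_eq (hFa z hz him.le)).1 ?_
        have hz' : z = (z.re : ℂ) := Complex.ext rfl (by simpa using him)
        have ht : Tendsto (fun t : ℝ => (t : ℂ)) (𝓝[≠] z.re) (𝓝[≠] z) := by
          refine tendsto_nhdsWithin_iff.2 ⟨?_, ?_⟩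
          · refine Tendsto.mono_left ?_ nhdsWithin_le_nhds
            exact Complex.continuous_ofReal.tendsto' _ _ hz'.symm
          · filter_upwards [self_mem_nhdsWithin] with t ht h
            exact ht (by simpa using congrArg Complex.re h)
        exact ht.frequently (Eventually.of_forall fun t => (hFreal t).symm).frequently
      filter_upwards [hev] with w hw
      by_cases h : 0 ≤ w.im
      · exact (if_pos h).symm
      · rw [hw]; exact (if_neg h).symm
    · refine (hf.analytic z him.le).congr ?_
      filter_upwards [(isOpen_lt continuous_const Complex.continuous_im).mem_nhds him] with w hw
      exact (if_pos (le_of_lt hw)).symm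
  · by_cases h : 0 ≤ z.im
    · simpa [hg, h] using h0' z hz h
    · have := h0' _ (hconj z hz) (by simpa using (not_le.1 h).le)
      simpa [hg, h, hF] using this
  · rcases lt_trichotomy z.im 0 with him | him | him
    · simp [hg, hF, him.not_ge, him.le]
    · have hz' : z = (z.re : ℂ) := Complex.ext rfl (by simpa using him)
      rw [hz', Complex.conj_ofReal]
      simp [hg, hf.norm_ofReal]
    · simp [hg, hF, him.not_ge, him.le]

/-- The antisymmetrized Poisson kernel of a disk centred on the real line. -/
theorem poissonKernel_sub_conj {x r : ℝ} {w z : ℂ} (hz : ‖z - x‖ = r) (hw : ‖w - x‖ < r) :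
    poissonKernel x w z - poissonKernel x (starRingEnd ℂ w) z =
      4 * w.im * z.im * (r ^ 2 - ‖w - x‖ ^ 2) /
        (‖z - w‖ ^ 2 * ‖z - starRingEnd ℂ w‖ ^ 2) := by
  have hwc : ‖starRingEnd ℂ w - x‖ = ‖w - x‖ := by
    rw [← Complex.norm_conj (w - x), map_sub, Complex.conj_ofReal]
  have h1 : z - w ≠ 0 := by
    rw [sub_ne_zero]; rintro rfl; exact hw.ne hz
  have h2 : z - starRingEnd ℂ w ≠ 0 := by
    rw [sub_ne_zero]; rintro rfl; exact hw.ne (hwc ▸ hz)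
  have h1' := norm_ne_zero_iff.2 h1
  have h2' := norm_ne_zero_iff.2 h2
  have h3 : ‖z - starRingEnd ℂ w‖ ^ 2 - ‖z - w‖ ^ 2 = 4 * w.im * z.im := by
    rw [← Complex.normSq_eq_norm_sq, ← Complex.normSq_eq_norm_sq, Complex.normSq_apply,
      Complex.normSq_apply]
    simp; ring
  rw [poissonKernel_def, poissonKernel_def, sub_sub_sub_cancel_right, sub_sub_sub_cancel_right,
    hwc, hz, ← h3]
  field_simp

/-- The first odd Fourier coefficient controls an antisymmetric harmonic function that is
nonnegative on the upper half of a disk, from both sides. -/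
theorem antisymmetric_harmonic_bounds {u : ℂ → ℝ} {x r ρ : ℝ} (hr : ρ < r)
    (hu : InnerProductSpace.HarmonicOnNhd u (Metric.closedBall x r))
    (hodd : ∀ z : ℂ, u (starRingEnd ℂ z) = - u z)
    (hpos : ∀ z : ℂ, 0 ≤ z.im → 0 ≤ u z) {w : ℂ} (hw : ‖w - x‖ ≤ ρ) (him : 0 ≤ w.im) :
    u w ≤ 2 * w.im * r ^ 2 / (r - ρ) ^ 4 *
        Real.circleAverage (fun z => z.im * u z) x r ∧
      2 * w.im * (r ^ 2 - ρ ^ 2) / (r + ρ) ^ 4 *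
        Real.circleAverage (fun z => z.im * u z) x r ≤ u w := by
  have hρ : 0 ≤ ρ := (norm_nonneg _).trans hw
  have hr0 : 0 < r := hρ.trans_lt hr
  have hwc : ‖starRingEnd ℂ w - x‖ = ‖w - x‖ := by
    rw [← Complex.norm_conj (w - x), map_sub, Complex.conj_ofReal]
  have hwb : w ∈ Metric.ball (x : ℂ) r := mem_ball_iff_norm.2 (hw.trans_lt hr)
  have hwcb : starRingEnd ℂ w ∈ Metric.ball (x : ℂ) r :=
    mem_ball_iff_norm.2 (hwc ▸ hw.trans_lt hr)
  have hcont : ContinuousOn u (Metric.sphere x r) := fun z hz =>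
    (hu z (Metric.sphere_subset_closedBall hz)).1.continuousAt.continuousWithinAt
  have hP {v : ℂ} (hv : v ∈ Metric.ball (x : ℂ) r) :
      CircleIntegrable (poissonKernel x v • u) x r := by
    refine ContinuousOn.circleIntegrable hr0.le (ContinuousOn.smul ?_ hcont)
    have hne : ∀ z ∈ Metric.sphere (x : ℂ) r, ‖z - x - (v - x)‖ ^ 2 ≠ 0 := fun z hz h => by
      have : z = v := by simpa [sub_eq_zero] using h
      subst this
      exact (Metric.mem_ball.1 hv).ne (Metric.mem_sphere.1 hz)
    unfold poissonKernel
    fun_prop (disch := assumption)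
  have hm : CircleIntegrable (fun z => z.im * u z) x r :=
    ContinuousOn.circleIntegrable hr0.le (by fun_prop)
  -- By oddness the Poisson integrals at `w` and its conjugate are `u w` and `-u w`. Their
  -- difference has a kernel proportional to `Im z`, and `z.im * u z ≥ 0` on the whole circle, so
  -- pointwise kernel bounds integrate.
  have hdiff : Real.circleAverage (fun z =>
      (poissonKernel x w z - poissonKernel x (starRingEnd ℂ w) z) * u z) x r = 2 * u w := by
    have h1 := hu.circleAverage_poissonKernel_smul hwb
    have h2 := hu.circleAverage_poissonKernel_smul hwcb
    have h3 := Real.circleAverage_sub (hP hwb) (hP hwcb)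
    rw [h1, h2, hodd] at h3
    rw [two_mul, ← sub_neg_eq_add, ← h3]
    congr 1
    ext z
    simp [sub_mul]
  have hK : CircleIntegrable (fun z =>
      (poissonKernel x w z - poissonKernel x (starRingEnd ℂ w) z) * u z) x r := by
    convert (hP hwb).sub (hP hwcb) using 1
    ext z
    simp [sub_mul]
  have hsign (z : ℂ) : 0 ≤ z.im * u z := by
    rcases le_total 0 z.im with h | h
    · exact mul_nonneg h (hpos z h)
    · refine mul_nonneg_of_nonpos_of_nonpos h ?_
      have := hpos (starRingEnd ℂ z) (by simpa using h)
      rw [hodd] at this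
      linarith
  have hdist {z v : ℂ} (hz : ‖z - x‖ = r) (hv : ‖v - x‖ ≤ ρ) :
      r - ρ ≤ ‖z - v‖ ∧ ‖z - v‖ ≤ r + ρ := by
    have e : z - v = (z - x) - (v - x) := by ring
    constructor
    · have := norm_sub_norm_le (z - x) (v - x)
      rw [e]; linarith
    · have := norm_sub_le (z - x) (v - x)
      rw [e]; linarith
  have hker (z : ℂ) (hz : z ∈ Metric.sphere (x : ℂ) |r|) :
      (poissonKernel x w z - poissonKernel x (starRingEnd ℂ w) z) * u z =
        4 * w.im * ((r ^ 2 - ‖w - x‖ ^ 2) /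
          (‖z - w‖ ^ 2 * ‖z - starRingEnd ℂ w‖ ^ 2)) * (z.im * u z) ∧
      (r ^ 2 - ‖w - x‖ ^ 2) / (‖z - w‖ ^ 2 * ‖z - starRingEnd ℂ w‖ ^ 2) ≤
        r ^ 2 / (r - ρ) ^ 4 ∧
      (r ^ 2 - ρ ^ 2) / (r + ρ) ^ 4 ≤
        (r ^ 2 - ‖w - x‖ ^ 2) / (‖z - w‖ ^ 2 * ‖z - starRingEnd ℂ w‖ ^ 2) := by
    rw [abs_of_pos hr0, mem_sphere_iff_norm] at hz
    obtain ⟨a1, a2⟩ := hdist hz hw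
    obtain ⟨b1, b2⟩ := hdist hz (hwc.trans_le hw)
    have hpos' : 0 < r - ρ := by linarith
    have e1 : (r - ρ) ^ 4 ≤ ‖z - w‖ ^ 2 * ‖z - starRingEnd ℂ w‖ ^ 2 := by
      rw [show (r - ρ) ^ 4 = (r - ρ) ^ 2 * (r - ρ) ^ 2 by ring]
      gcongr
    have e2 : ‖z - w‖ ^ 2 * ‖z - starRingEnd ℂ w‖ ^ 2 ≤ (r + ρ) ^ 4 := by
      rw [show (r + ρ) ^ 4 = (r + ρ) ^ 2 * (r + ρ) ^ 2 by ring]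
      gcongr
    have e0 : 0 < ‖z - w‖ ^ 2 * ‖z - starRingEnd ℂ w‖ ^ 2 :=
      lt_of_lt_of_le (by positivity) e1
    have e3 : ‖w - x‖ ^ 2 ≤ ρ ^ 2 := by gcongr
    have e4 : ρ ^ 2 ≤ r ^ 2 := by gcongr
    refine ⟨?_, ?_, ?_⟩
    · rw [poissonKernel_sub_conj hz (hw.trans_lt hr)]; ring
    · exact div_le_div₀ (by positivity) (by nlinarith [norm_nonneg (w - x)]) (by positivity) e1
    · exact div_le_div₀ (by linarith) (by linarith) e0 e2
  have upper := Real.circleAverage_mono hK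
    (hm.const_smul (a := 4 * w.im * (r ^ 2 / (r - ρ) ^ 4))) fun z hz => by
      obtain ⟨h1, h2, -⟩ := hker z hz
      rw [h1, Pi.smul_apply, smul_eq_mul]
      exact mul_le_mul_of_nonneg_right (mul_le_mul_of_nonneg_left h2 (by positivity)) (hsign z)
  have lower := Real.circleAverage_mono
    (hm.const_smul (a := 4 * w.im * ((r ^ 2 - ρ ^ 2) / (r + ρ) ^ 4))) hK fun z hz => by
      obtain ⟨h1, -, h2⟩ := hker z hz
      rw [h1, Pi.smul_apply, smul_eq_mul]
      exact mul_le_mul_of_nonneg_right (mul_le_mul_of_nonneg_left h2 (by positivity)) (hsign z)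
  rw [hdiff, Real.circleAverage_smul, smul_eq_mul] at upper lower
  constructor
  · have : 2 * w.im * r ^ 2 / (r - ρ) ^ 4 = 4 * w.im * (r ^ 2 / (r - ρ) ^ 4) / 2 := by ring
    rw [this]; linarith
  · have : 2 * w.im * (r ^ 2 - ρ ^ 2) / (r + ρ) ^ 4 =
        4 * w.im * ((r ^ 2 - ρ ^ 2) / (r + ρ) ^ 4) / 2 := by ring
    rw [this]; linarith

/-- The derivative is `Re (i f'/f)`, and `f'/f = i |f'|` on the real line. -/
theorem IsRegularInner.hasDerivAt_log_norm {f : ℂ → ℂ} (hf : IsRegularInner f) (s : ℝ) :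
    HasDerivAt (fun t : ℝ => Real.log ‖f (s + t * Complex.I)‖) (-‖deriv f s‖) 0 := by
  have hd : HasDerivAt f (deriv f s) (s : ℂ) :=
    (hf.analytic s (by simp)).differentiableAt.hasDerivAt
  have h1 : HasDerivAt (fun t : ℝ => (s : ℂ) + t * Complex.I) Complex.I 0 := by
    simpa using ((Complex.ofRealCLM.hasDerivAt (x := (0 : ℝ))).mul_const Complex.I).const_add (s : ℂ)
  have h2 : HasDerivAt (fun t : ℝ => f (s + t * Complex.I)) (deriv f s * Complex.I) 0 :=
    HasDerivAt.comp (h₂ := f) (0 : ℝ) (by simpa using hd) h1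
  have hfs : ‖f s‖ = 1 := hf.norm_ofReal s
  have h3 := (h2.norm_sq.log (by simp [hfs])).div_const 2
  have hfun : (fun t : ℝ => Real.log ‖f (s + t * Complex.I)‖) =
      fun t : ℝ => Real.log (‖f (s + t * Complex.I)‖ ^ 2) / 2 := by
    ext t
    rw [Real.log_pow]; push_cast; ring
  rw [hfun]
  refine h3.congr_deriv ?_
  have hz : (s : ℂ) + ((0 : ℝ) : ℂ) * Complex.I = s := by simp
  simp only [hz, Complex.inner, hfs]
  have hA : deriv f s * Complex.I * starRingEnd ℂ (f s) = ((-‖deriv f s‖ : ℝ) : ℂ) := by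
    have hfs' : f s * starRingEnd ℂ (f s) = 1 := by
      rw [Complex.mul_conj, Complex.normSq_eq_norm_sq, hfs]; simp
    have h := hf.deriv_ofReal s
    calc deriv f s * Complex.I * starRingEnd ℂ (f s)
        = (Complex.I * ‖deriv f s‖ * f s) * Complex.I * starRingEnd ℂ (f s) := by rw [← h]
      _ = (Complex.I * Complex.I) * ‖deriv f s‖ * (f s * starRingEnd ℂ (f s)) := by ring
      _ = _ := by rw [Complex.I_mul_I, hfs']; push_cast; ring
  rw [hA, Complex.ofReal_re]
  ring

/-! ### Comparison of boundary derivatives -/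

/-- Harnack-type comparison of boundary derivatives for a regular inner function without zeros in a
disk. -/
theorem IsRegularInner.norm_deriv_le_of_zero_free {f : ℂ → ℂ} (hf : IsRegularInner f)
    {x y r R ρ C : ℝ} (hxy : |y - x| < ρ) (hr : ρ < r) (hR : r < R) (hC : 0 ≤ C)
    (h0 : ∀ z ∈ Metric.ball (x : ℂ) R, 0 < z.im → f z ≠ 0)
    (hCr : r ^ 2 / (r - ρ) ^ 4 ≤ C * ((r ^ 2 - ρ ^ 2) / (r + ρ) ^ 4)) :
    ‖deriv f x‖ ≤ C * ‖deriv f y‖ := by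
  obtain ⟨g, hga, hg0, hgf, hgc⟩ := hf.exists_reflection h0
  have hu : InnerProductSpace.HarmonicOnNhd (fun z => -Real.log ‖g z‖)
      (Metric.closedBall x r) := fun z hz =>
    ((hga z (Metric.closedBall_subset_ball hR hz)).harmonicAt_log_norm
      (hg0 z (Metric.closedBall_subset_ball hR hz))).neg
  have hpos (z : ℂ) (hz : 0 ≤ z.im) : 0 ≤ -Real.log ‖g z‖ := by
    rw [hgf z hz]
    linarith [Real.log_nonpos (norm_nonneg _) (hf.norm_le_one z hz)]
  have hodd (z : ℂ) : -Real.log ‖g (starRingEnd ℂ z)‖ = - -Real.log ‖g z‖ := by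
    rw [hgc, Real.log_inv]
  set m := Real.circleAverage (fun z => z.im * -Real.log ‖g z‖) x r with hm
  have hsign (z : ℂ) : 0 ≤ z.im * -Real.log ‖g z‖ := by
    rcases le_total 0 z.im with h | h
    · exact mul_nonneg h (hpos z h)
    · refine mul_nonneg_of_nonpos_of_nonpos h ?_
      have := hpos (starRingEnd ℂ z) (by simpa using h)
      rw [hodd] at this
      linarith
  have hm0 : 0 ≤ m := Real.circleAverage_nonneg_of_nonneg fun z _ => hsign z
  have hnorm (s t : ℝ) : ‖(s : ℂ) + t * Complex.I - x‖ ≤ |s - x| + |t| := by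
    have : (s : ℂ) + t * Complex.I - x = ((s - x : ℝ) : ℂ) + t * Complex.I := by push_cast; ring
    rw [this]
    refine (norm_add_le _ _).trans (le_of_eq ?_)
    rw [Complex.norm_real, norm_mul, Complex.norm_I, mul_one, Complex.norm_real, Real.norm_eq_abs,
      Real.norm_eq_abs]
  -- `D 0 = 0` and the two-sided bounds give `D ≥ 0` for small `t ≥ 0`; the sign of the right
  -- derivative at `0` is the claim.
  set D : ℝ → ℝ := fun t => Real.log ‖f (x + t * Complex.I)‖ -
    C * Real.log ‖f (y + t * Complex.I)‖ with hD
  have hDd : HasDerivAt D (-‖deriv f x‖ - C * -‖deriv f y‖) 0 :=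
    (hf.hasDerivAt_log_norm x).sub ((hf.hasDerivAt_log_norm y).const_mul C)
  have hmin : IsLocalMinOn D (Set.Ici 0) 0 := by
    have hsmall : ∀ᶠ t : ℝ in 𝓝[≥] 0, t < ρ - |y - x| :=
      mem_nhdsWithin_of_mem_nhds (Iio_mem_nhds (by linarith))
    filter_upwards [self_mem_nhdsWithin, hsmall] with t ht hts
    have ht0 : 0 ≤ t := ht
    have hD0 : D 0 = 0 := by simp [hD, hf.norm_ofReal]
    rw [hD0]
    have hx := (antisymmetric_harmonic_bounds hr hu hodd hpos (w := x + t * Complex.I)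
      ((hnorm x t).trans (by
        rw [sub_self, abs_zero, abs_of_nonneg ht0]; linarith [abs_nonneg (y - x)]))
      (by simpa using ht0)).1
    have hy := (antisymmetric_harmonic_bounds hr hu hodd hpos (w := y + t * Complex.I)
      ((hnorm y t).trans (by rw [abs_of_nonneg ht0]; linarith))
      (by simpa using ht0)).2
    rw [hgf _ (by simpa using ht0), ← hm] at hx hy
    have hi (s : ℝ) : ((s : ℂ) + t * Complex.I).im = t := by simp
    rw [hi] at hx hy
    have h1 := mul_le_mul_of_nonneg_left hy hC
    have h2 := mul_le_mul_of_nonneg_left hCr (mul_nonneg (mul_nonneg zero_le_two ht0) hm0)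
    have e1 : 2 * t * r ^ 2 / (r - ρ) ^ 4 * m = 2 * t * m * (r ^ 2 / (r - ρ) ^ 4) := by ring
    have e2 : C * (2 * t * (r ^ 2 - ρ ^ 2) / (r + ρ) ^ 4 * m) =
        2 * t * m * (C * ((r ^ 2 - ρ ^ 2) / (r + ρ) ^ 4)) := by ring
    rw [e1] at hx
    rw [e2] at h1
    simp only [hD]
    linarith
  have := hmin.hasFDerivWithinAt_nonneg hDd.hasDerivWithinAt.hasFDerivWithinAt (y := 1)
    (mem_posTangentConeAt_of_segment_subset (by
      rw [zero_add, segment_eq_Icc zero_le_one]; exact Set.Icc_subset_Ici_self))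
  have h' : 0 ≤ -‖deriv f x‖ - C * -‖deriv f y‖ := by simpa using this
  linarith

/-- If zero-free regular inner functions and the Blaschke factors of all zeros satisfy a comparison
of boundary derivatives, then so does the function itself. -/
theorem IsRegularInner.norm_deriv_le {x y M C c : ℝ} (hc : 0 < c)
    (hfree : ∀ f : ℂ → ℂ, IsRegularInner f →
      (∀ z ∈ Metric.ball (x : ℂ) M, 0 < z.im → f z ≠ 0) → ‖deriv f x‖ ≤ C * ‖deriv f y‖)
    (n : ℕ) : ∀ f : ℂ → ℂ, IsRegularInner f → ‖deriv f x‖ ≤ n * c →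
      (∀ l ∈ Metric.ball (x : ℂ) M, 0 < l.im → f l = 0 →
        c ≤ 2 * l.im / ‖(x : ℂ) - l‖ ^ 2 ∧
        2 * l.im / ‖(x : ℂ) - l‖ ^ 2 ≤ C * (2 * l.im / ‖(y : ℂ) - l‖ ^ 2)) →
      ‖deriv f x‖ ≤ C * ‖deriv f y‖ := by
  induction n with
  -- Here `f'(x) = 0`, while any zero in the ball would contribute at least `c > 0`.
  | zero =>
    intro f hf hn hzero
    refine hfree f hf fun l hl hl0 h0 => ?_
    obtain ⟨g, hg, hfg⟩ := hf.exists_blaschke_factor hl0 h0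
    have h1 := hf.norm_deriv_of_factor hg hl0 hfg x
    have h2 := (hzero l hl hl0 h0).1
    have h3 := norm_nonneg (deriv g x)
    rw [Nat.cast_zero, zero_mul] at hn
    linarith
  | succ n ih =>
    intro f hf hn hzero
    by_cases hex : ∃ l ∈ Metric.ball (x : ℂ) M, 0 < l.im ∧ f l = 0
    · obtain ⟨l, hl, hl0, h0⟩ := hex
      obtain ⟨g, hg, hfg⟩ := hf.exists_blaschke_factor hl0 h0
      have hx := hf.norm_deriv_of_factor hg hl0 hfg x
      have hy := hf.norm_deriv_of_factor hg hl0 hfg y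
      obtain ⟨h1, h2⟩ := hzero l hl hl0 h0
      have := ih g hg (by push_cast at hn; linarith) fun z hz hz0 hgz => by
        -- Zeros of `g` above the axis are zeros of `f`, since `z` is not the conjugate of `l`.
        refine hzero z hz hz0 ?_
        have h := hfg z
        rw [hgz, mul_zero] at h
        refine (mul_eq_zero.1 h).resolve_left fun h' => ?_
        have := congrArg Complex.im h'
        simp at this
        linarith
      rw [hx, hy, mul_add]
      linarith
    · push Not at hex
      exact hfree f hf hex

/-- The zeros of a regular inner function in a bounded part of the half-plane stay away from the
real line. -/
theorem IsRegularInner.exists_im_lower_bound {f : ℂ → ℂ} (hf : IsRegularInner f) (x M : ℝ) :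
    ∃ η > 0, ∀ l ∈ Metric.ball (x : ℂ) M, 0 < l.im → f l = 0 → η ≤ l.im := by
  set K : Set ℂ := Metric.closedBall (x : ℂ) M ∩ {z | 0 ≤ z.im} with hK
  have hKc : IsCompact K := (isCompact_closedBall _ _).inter_right
    (isClosed_le continuous_const Complex.continuous_im)
  have hfc : ContinuousOn f K := hf.analytic.continuousOn.mono Set.inter_subset_right
  have hZ : IsCompact (K ∩ f ⁻¹' {0}) :=
    hKc.of_isClosed_subset (hfc.preimage_isClosed_of_isClosed hKc.isClosed isClosed_singleton)
      Set.inter_subset_left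
  rcases (K ∩ f ⁻¹' {0}).eq_empty_or_nonempty with he | hne
  · refine ⟨1, one_pos, fun l hl hl0 h0 => ?_⟩
    have : l ∈ K ∩ f ⁻¹' {0} := ⟨⟨Metric.ball_subset_closedBall hl, hl0.le⟩, h0⟩
    rw [he] at this
    exact this.elim
  · obtain ⟨p, ⟨⟨-, hp⟩, hp0⟩, hmin⟩ :=
      hZ.exists_isMinOn hne Complex.continuous_im.continuousOn
    refine ⟨p.im, (show 0 ≤ p.im from hp).lt_of_ne fun h => ?_, fun l hl hl0 h0 =>
      hmin ⟨⟨Metric.ball_subset_closedBall hl, hl0.le⟩, h0⟩⟩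
    have h1 := hf.norm_ofReal p.re
    rw [show (p.re : ℂ) = p from Complex.ext rfl (by simpa using h), show f p = 0 from hp0] at h1
    simp at h1

/-! ### The main theorem -/

theorem mainTheorem10 :
    ∃ ε₀ : ℝ, 0 < ε₀ ∧
      ∀ ε : ℝ, 0 < ε → ε < ε₀ →
        ∀ θ : ℂ → ℂ, IsMeromorphicInner θ →
          ∀ x y : ℝ, 1 + ε < ‖deriv θ (x : ℂ)‖ / ‖deriv θ (y : ℂ)‖ →
            ∃ z : ℂ, ‖z - (x : ℂ)‖ < 4 * |y - x| / ε ∧ IsZeroOf θ z := by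
  refine ⟨1, one_pos, fun ε hε hε1 θ hθ x y hxy => ?_⟩
  have hf := hθ.isRegularInner
  by_contra! hno
  -- Division by zero gives `0`, so the ratio hypothesis already forces `θ'(y) ≠ 0`.
  have hy0 : 0 < ‖deriv θ (y : ℂ)‖ := by
    refine (norm_nonneg _).lt_of_ne fun h => ?_
    rw [← h, div_zero] at hxy
    linarith
  rw [lt_div_iff₀ hy0] at hxy
  have hd : 0 < |y - x| := by
    rw [abs_pos, sub_ne_zero]
    rintro rfl
    nlinarith
  set d := |y - x| with hd_def
  have hfar (l : ℂ) (hl : 0 < l.im) (h0 : θ l = 0) : 4 * d / ε ≤ ‖(x : ℂ) - l‖ := by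
    rw [norm_sub_rev]
    by_contra! h
    exact hno l h ⟨hf.analytic l hl.le, h0⟩
  -- With `ρ = 2d` this makes `ρ / r = ε / 100 = δ`, and the Harnack constant is controlled by `(1 +
  -- δ)⁴ ≤ (1 + 100δ)(1 - δ²)(1 - δ)⁴`.
  set r : ℝ := 200 * d / ε with hr
  have hrd : r * ε = 200 * d := by rw [hr]; field_simp
  have hr0 : 0 < r := by positivity
  have hrr : 2 * d < r := by nlinarith
  have hδ : 2 * d = r * (ε / 100) := by linarith
  have hfree : ∀ f : ℂ → ℂ, IsRegularInner f →
      (∀ z ∈ Metric.ball (x : ℂ) (2 * r), 0 < z.im → f z ≠ 0) →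
      ‖deriv f x‖ ≤ (1 + ε) * ‖deriv f y‖ := fun f hf h0 => by
    refine hf.norm_deriv_le_of_zero_free (ρ := 2 * d) (r := r) (R := 2 * r) (by linarith)
      hrr (by linarith) (by linarith) h0 ?_
    rw [hδ]
    set δ := ε / 100 with hδ'
    have hδ0 : 0 < δ := by positivity
    have hδ1 : δ < 1 / 100 := by linarith
    rw [← mul_div_assoc (1 + ε), div_le_div_iff₀ (pow_pos (by nlinarith) 4) (by positivity)]
    have e1 : r ^ 2 * (r + r * δ) ^ 4 = r ^ 6 * (1 + δ) ^ 4 := by ring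
    have e2 : (1 + ε) * (r ^ 2 - (r * δ) ^ 2) * (r - r * δ) ^ 4 =
        r ^ 6 * ((1 + 100 * δ) * (1 - δ ^ 2) * (1 - δ) ^ 4) := by rw [hδ']; ring
    rw [e1, e2]
    refine mul_le_mul_of_nonneg_left ?_ (by positivity)
    have b1 : (1 + δ) ^ 2 ≤ 1 + 3 * δ := by nlinarith
    have b2 : (1 + δ) ^ 4 ≤ 1 + 7 * δ := by
      calc (1 + δ) ^ 4 = ((1 + δ) ^ 2) ^ 2 := by ring
        _ ≤ (1 + 3 * δ) ^ 2 := by gcongr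
        _ ≤ 1 + 7 * δ := by nlinarith
    have b3 : 1 - 4 * δ ≤ (1 - δ) ^ 4 := by
      have := one_add_mul_le_pow (a := -δ) (by linarith) 4
      norm_num at this
      linarith
    have b4 : 1 - δ ≤ 1 - δ ^ 2 := by nlinarith
    calc (1 + δ) ^ 4 ≤ 1 + 7 * δ := b2
      _ ≤ (1 + 100 * δ) * (1 - δ) * (1 - 4 * δ) := by nlinarith [pow_pos hδ0 2, pow_pos hδ0 3]
      _ ≤ (1 + 100 * δ) * (1 - δ ^ 2) * (1 - δ) ^ 4 := by
        refine mul_le_mul (mul_le_mul_of_nonneg_left b4 (by linarith)) b3 (by linarith) ?_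
        exact mul_nonneg (by linarith) (by nlinarith)
  obtain ⟨η, hη, hηl⟩ := hf.exists_im_lower_bound x (2 * r)
  -- Least possible contribution to `|θ'(x)|` of a zero in the ball of radius `2r`; it bounds the
  -- number of divisions.
  set c := 2 * η / (2 * r) ^ 2 with hc
  have hc0 : 0 < c := by positivity
  obtain ⟨n, hn⟩ := exists_nat_ge (‖deriv θ x‖ / c)
  refine absurd (IsRegularInner.norm_deriv_le hc0 hfree n θ hf ((div_le_iff₀ hc0).1 hn)
    fun l hl hl0 h0 => ?_) (not_le.2 hxy)
  have hX := hfar l hl0 h0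
  have hX0 : 0 < ‖(x : ℂ) - l‖ := lt_of_lt_of_le (by positivity) hX
  have hY0 : 0 < ‖(y : ℂ) - l‖ := by
    rw [norm_pos_iff, sub_ne_zero]
    rintro rfl
    simp at hl0
  constructor
  · rw [Metric.mem_ball, dist_comm, dist_eq_norm] at hl
    have := hηl l (by rwa [Metric.mem_ball, dist_comm, dist_eq_norm]) hl0 h0
    rw [hc]
    gcongr
  -- From `4d/ε ≤ |x - l|` one gets `d ≤ (ε/4) |x - l|`.
  · have hY : ‖(y : ℂ) - l‖ ≤ (1 + ε / 4) * ‖(x : ℂ) - l‖ := by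
      have h1 := norm_add_le ((y : ℂ) - x) (x - l)
      rw [sub_add_sub_cancel, ← Complex.ofReal_sub, Complex.norm_real, Real.norm_eq_abs,
        ← hd_def] at h1
      rw [div_le_iff₀ hε] at hX
      linarith
    have h2 : ‖(y : ℂ) - l‖ ^ 2 ≤ (1 + ε) * ‖(x : ℂ) - l‖ ^ 2 := by
      calc ‖(y : ℂ) - l‖ ^ 2 ≤ ((1 + ε / 4) * ‖(x : ℂ) - l‖) ^ 2 := by gcongr
        _ = (1 + ε / 4) ^ 2 * ‖(x : ℂ) - l‖ ^ 2 := by ring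
        _ ≤ _ := by
          refine mul_le_mul_of_nonneg_right ?_ (by positivity)
          nlinarith
    rw [← mul_div_assoc, div_le_div_iff₀ (by positivity) (by positivity)]
    nlinarith
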